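/- Let $G$ be a group. A Yetter--Drinfeld module over $G$ is a complex $G$-module $Y$ with a grading $Y=\bigoplus_{g\in G}Y_g$ such that $g\triangleright Y_h=Y_{ghg^{-1}}$ for all $g,h\in G$. With linear maps commuting with the $G$-action and preserving the $G$-grading as morphisms, these form a category $\mathcal{YD}(G)$, which is monoidal: $Y\otimes Z$ carries the diagonal action and the grading $(Y\otimes Z)_g=\sum_{hk=g}Y_h\otimes Z_k$, and the unit object is $\mathbb C$ with trivial action, in degree $1$. An algebra in $\mathcal{YD}(G)$ is an associative unital algebra $A$ with a Yetter--Drinfeld module structure such that the multiplication $A\otimes A\to A$ and the unit $\mathbb C\to A$ are morphisms in $\mathcal{YD}(G)$. Let $V^-,V^+$ be $G$-modules, $\beta\colon V^+\otimes V^-\to\mathbb CG$ a linear map, and $R^\pm\subset T(V^\pm)$ subspaces. Write $T(V^-\oplus V^+)\rtimes G$ for the semidirect product, in which $ga=(g\triangleright a)g$, and let $$A_\beta(R^-,R^+)=\bigl(T(V^-\oplus V^+)\rtimes G\bigr)\big/\bigl\langle R^-,\ R^+,\ fv-vf-\beta(f\otimes v)\ (f\in V^+,\,v\in V^-)\bigr\rangle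 .$$ Let $I_\beta^-$ be the sum of all $G$-invariant graded two-sided ideals $I^-\subset T^{>0}(V^-)$ with $[V^+,I^-]\subset I^-\cdot\mathbb CG$ in $A_\beta(0,0)$, and let $I_\beta^+$ be the sum of all $G$-invariant graded two-sided ideals $I^+\subset T^{>0}(V^+)$ with $[I^+,V^-]\subset\mathbb CG\cdot I^+$ in $A_\beta(0,0)$. Let $Y$ be a finite-dimensional Yetter--Drinfeld module over $G$. The braided Heisenberg double $\mathcal H_Y$ is the minimal double $A_\beta(I_\beta^-,I_\beta^+)$ for $V^-=Y$, $V^+=Y^*$ (with the contragredient action) and $\beta(f\otimes v)=\langle f,v\rangle\,g$ for $f\in Y^*$, $v\in Y_g$, $g\in G$. **Proposition.** 1. The group $G$ acts on $\mathcal H_Y$ by conjugation, $g\triangleright x=gxg^{-1}$, and this action is by algebra automorphisms. 2. There is an algebra grading $\mathcal H_Y=\bigoplus_{g\in G}(\mathcal H_Y)_g$ (so $1\in(\mathcal H_Y)_1$ and $(\mathcal H_Y)_g(\mathcal H_Y)_h\subset(\mathcal H_Y)_{gh}$) such that each $g\in G$ has degree $g$, each $v\in Y_g$ has degree $g$, and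 all elements of $Y^*$ have degree $1$. 3. This action and this grading make $\mathcal H_Y$ an algebra in the category $\mathcal{YD}(G)$. -/

import Mathlib

open scoped TensorProduct

noncomputable section

/-! ### Yetter-Drinfeld modules over a group -/

/-- A Yetter-Drinfeld module structure for `ℂG` on the complex vector space `V`: an action of `G`
and a `G`-grading `V = ⨁ V_g` such that `g ▹ V_h = V_{ghg⁻¹}`. The directness of the sum is stated
as independence of the subspaces together with `⨆ V_g = V`. -/
structure YDModule (G : Type*) [Group G] (V : Type*) [AddCommGroup V] [Module ℂ V] where
  /-- the action of `G` -/
  act : Representation ℂ G V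
  /-- the homogeneous components -/
  gr : G → Submodule ℂ V
  indep : iSupIndep gr
  iSup_eq_top : ⨆ g, gr g = ⊤
  compat : ∀ g h : G, (gr h).map (act g) = gr (g * h * g⁻¹)

namespace YDModule

section Basic

variable {G : Type*} [Group G]
variable {V : Type*} [AddCommGroup V] [Module ℂ V]
variable {W : Type*} [AddCommGroup W] [Module ℂ W]

open Classical in
theorem isInternal (M : YDModule G V) : DirectSum.IsInternal M.gr :=
  (DirectSum.isInternal_submodule_iff_iSupIndep_and_iSup_eq_top M.gr).2 ⟨M.indep, M.iSup_eq_top⟩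

open Classical in
/-- The coaction `δ : V → V ⊗ ℂG`, `δ(v) = v ⊗ g` for `v ∈ V_g`. -/
def coaction (M : YDModule G V) : V →ₗ[ℂ] V ⊗[ℂ] MonoidAlgebra ℂ G :=
  (DirectSum.toModule ℂ G (V ⊗[ℂ] MonoidAlgebra ℂ G) fun g =>
    ((TensorProduct.mk ℂ V (MonoidAlgebra ℂ G)).flip (MonoidAlgebra.of ℂ G g)) ∘ₗ
      (M.gr g).subtype) ∘ₗ
  (LinearEquiv.ofBijective (DirectSum.coeLinearMap M.gr) M.isInternal).symm.toLinearMap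

theorem coaction_of_mem (M : YDModule G V) {g : G} {v : V} (hv : v ∈ M.gr g) :
    M.coaction v = v ⊗ₜ MonoidAlgebra.of ℂ G g := by
  classical
  have h : (LinearEquiv.ofBijective (DirectSum.coeLinearMap M.gr) M.isInternal).symm v =
      DirectSum.lof ℂ G (fun i => M.gr i) g ⟨v, hv⟩ := by
    rw [LinearEquiv.symm_apply_eq]
    exact (DirectSum.coeLinearMap_lof M.gr g ⟨v, hv⟩).symm
  have h' : M.coaction v = (DirectSum.toModule ℂ G (V ⊗[ℂ] MonoidAlgebra ℂ G) fun g =>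
      ((TensorProduct.mk ℂ V (MonoidAlgebra ℂ G)).flip (MonoidAlgebra.of ℂ G g)) ∘ₗ
        (M.gr g).subtype)
      ((LinearEquiv.ofBijective (DirectSum.coeLinearMap M.gr) M.isInternal).symm v) := by
    unfold coaction
    rw [LinearMap.comp_apply]
    congr!
  rw [h', h, DirectSum.toModule_lof]
  simp

/-- A family of subspaces is independent as soon as some linear map separates its members by their
index in the way that a coaction does. -/
theorem iSupIndep_of_coaction (gr : G → Submodule ℂ V) (δ : V →ₗ[ℂ] V ⊗[ℂ] MonoidAlgebra ℂ G)
    (h : ∀ g, ∀ v ∈ gr g, δ v = v ⊗ₜ MonoidAlgebra.of ℂ G g) : iSupIndep gr := by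
  classical
  -- the component of degree `g` of `δ`
  let e : G → V ⊗[ℂ] MonoidAlgebra ℂ G →ₗ[ℂ] V := fun g =>
    (TensorProduct.rid ℂ V).toLinearMap ∘ₗ LinearMap.lTensor V
      ((Finsupp.lapply g) ∘ₗ (MonoidAlgebra.coeffLinearEquiv ℂ).toLinearMap)
  have he : ∀ g k, ∀ v ∈ gr k, e g (δ v) = if k = g then v else 0 := by
    intro g k v hv
    rw [h k v hv]
    by_cases hk : k = g
    · subst hk; simp [e]
    · simp [e, hk]
  rw [iSupIndep_def]
  intro g
  rw [Submodule.disjoint_def]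
  intro x hx hx'
  have h0 : (⨆ j, ⨆ (_ : j ≠ g), gr j) ≤ LinearMap.ker (e g ∘ₗ δ) := by
    refine iSup₂_le fun j hj v hv => ?_
    rw [LinearMap.mem_ker, LinearMap.comp_apply, he g j v hv, if_neg hj]
  have h1 := LinearMap.mem_ker.1 (h0 hx')
  rw [LinearMap.comp_apply, he g g x hx, if_pos rfl] at h1
  exact h1

/-- The tensor product of two Yetter-Drinfeld modules: the diagonal action, and the grading
`(V ⊗ W)_g = ∑_{hk = g} V_h ⊗ W_k`. -/
def tensor (M : YDModule G V) (N : YDModule G W) : YDModule G (V ⊗[ℂ] W) where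
  act := M.act.tprod N.act
  gr g := ⨆ h : G, Submodule.map₂ (TensorProduct.mk ℂ V W) (M.gr h) (N.gr (h⁻¹ * g))
  indep := by
    refine iSupIndep_of_coaction _
      ((LinearMap.lTensor (V ⊗[ℂ] W) (LinearMap.mul' ℂ (MonoidAlgebra ℂ G))) ∘ₗ
        (TensorProduct.tensorTensorTensorComm ℂ V (MonoidAlgebra ℂ G) W
          (MonoidAlgebra ℂ G)).toLinearMap ∘ₗ
        TensorProduct.map M.coaction N.coaction) ?_
    intro g x hx
    rw [← TensorProduct.mk_apply, ← LinearMap.flip_apply, ← LinearMap.mem_eqLocus]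
    refine (iSup_le fun h => Submodule.map₂_le.2 fun a ha b hb => ?_ :
      (⨆ h : G, Submodule.map₂ (TensorProduct.mk ℂ V W) (M.gr h) (N.gr (h⁻¹ * g))) ≤ _) hx
    simp [coaction_of_mem M ha, coaction_of_mem N hb]
  iSup_eq_top := by
    rw [eq_top_iff, ← TensorProduct.map₂_mk_top_top_eq_top, ← M.iSup_eq_top, ← N.iSup_eq_top,
      Submodule.map₂_iSup_left]
    refine iSup_le fun h => ?_
    rw [Submodule.map₂_iSup_right]
    refine iSup_le fun k => le_iSup_of_le (h * k) (le_iSup_of_le h ?_)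
    simp
  compat g h := by
    rw [Submodule.map_iSup]
    have key : ∀ k : G,
        (Submodule.map₂ (TensorProduct.mk ℂ V W) (M.gr k) (N.gr (k⁻¹ * h))).map
          (M.act.tprod N.act g) =
        Submodule.map₂ (TensorProduct.mk ℂ V W) (M.gr (g * k * g⁻¹))
          (N.gr ((g * k * g⁻¹)⁻¹ * (g * h * g⁻¹))) := by
      intro k
      have e : (g * k * g⁻¹)⁻¹ * (g * h * g⁻¹) = g * (k⁻¹ * h) * g⁻¹ := by group
      rw [e, ← M.compat, ← N.compat, Submodule.map_map₂, Submodule.map₂_map_map]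
      rfl
    simp_rw [key]
    exact (MulAut.conj g).toEquiv.iSup_comp
      (g := fun k => Submodule.map₂ (TensorProduct.mk ℂ V W) (M.gr k)
        (N.gr (k⁻¹ * (g * h * g⁻¹))))

variable (G) in
/-- The unit object: `ℂ` with the trivial action, in degree `1`. -/
def unit : YDModule G ℂ where
  act := Representation.trivial ℂ G ℂ
  gr g := ⨆ (_ : g = 1), ⊤
  indep := by
    refine iSupIndep_of_coaction _
      ((TensorProduct.mk ℂ ℂ (MonoidAlgebra ℂ G)).flip (MonoidAlgebra.of ℂ G 1)) ?_
    intro g v hv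
    by_cases hg : g = 1
    · subst hg; simp
    · simp only [hg, iSup_false, Submodule.mem_bot] at hv
      subst hv; simp
  iSup_eq_top := by simp
  compat g h := by
    have e : g * h * g⁻¹ = 1 ↔ h = 1 := by simp
    by_cases hh : h = 1
    · subst hh
      simp only [iSup_pos, mul_one, mul_inv_cancel, Submodule.map_top, LinearMap.range_eq_top]
      exact fun x => ⟨x, rfl⟩
    · simp [hh]

/-- Morphisms of Yetter-Drinfeld modules: linear maps that commute with the action and preserve
the grading. -/
structure IsHom (M : YDModule G V) (N : YDModule G W) (φ : V →ₗ[ℂ] W) : Prop where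
  map_act : ∀ (g : G) (v : V), φ (M.act g v) = N.act g (φ v)
  map_gr : ∀ (g : G), ∀ v ∈ M.gr g, φ v ∈ N.gr g

/-- The associative unital algebra `A` is, with the given Yetter-Drinfeld module structure, an
algebra in the monoidal category of Yetter-Drinfeld modules: its multiplication `A ⊗ A → A` and its
unit `ℂ → A` are morphisms of that category. -/
structure IsAlgebra {A : Type*} [Ring A] [Algebra ℂ A] (M : YDModule G A) : Prop where
  mul : IsHom (M.tensor M) M (LinearMap.mul' ℂ A)
  unit : IsHom (YDModule.unit G) M (Algebra.linearMap ℂ A)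

/-- `β(f ⊗ v) = ⟨f, v⁽⁰⁾⟩ v⁽¹⁾`. -/
def heisenbergForm (M : YDModule G V) :
    Module.Dual ℂ V →ₗ[ℂ] V →ₗ[ℂ] MonoidAlgebra ℂ G :=
  LinearMap.mk₂ ℂ
    (fun f v => TensorProduct.lid ℂ (MonoidAlgebra ℂ G)
      (LinearMap.rTensor (MonoidAlgebra ℂ G) f (M.coaction v)))
    (by intros; simp [LinearMap.rTensor_add]) (by intros; simp [LinearMap.rTensor_smul])
    (by intros; simp) (by intros; simp)

theorem heisenbergForm_of_mem (M : YDModule G V) (f : Module.Dual ℂ V) {g : G} {v : V}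
    (hv : v ∈ M.gr g) : M.heisenbergForm f v = f v • MonoidAlgebra.of ℂ G g := by
  simp [heisenbergForm, coaction_of_mem M hv]

end Basic

end YDModule

/-! ### Semidirect products `T(V) ⋊ G` -/

section Semidirect

variable {G : Type*} [Group G] {V : Type*} [AddCommGroup V] [Module ℂ V]

/-- The algebra map `T(V) → T(W)` that extends a linear map `V → W`. -/
def tensorMap {W : Type*} [AddCommGroup W] [Module ℂ W] (φ : V →ₗ[ℂ] W) :
    TensorAlgebra ℂ V →ₐ[ℂ] TensorAlgebra ℂ W :=
  TensorAlgebra.lift ℂ (TensorAlgebra.ι ℂ ∘ₗ φ)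

theorem tensorMap_id : tensorMap (LinearMap.id : V →ₗ[ℂ] V) = AlgHom.id ℂ _ := by
  ext; simp [tensorMap]

theorem tensorMap_comp {W X : Type*} [AddCommGroup W] [Module ℂ W] [AddCommGroup X] [Module ℂ X]
    (φ : W →ₗ[ℂ] X) (ψ : V →ₗ[ℂ] W) :
    tensorMap (φ ∘ₗ ψ) = (tensorMap φ).comp (tensorMap ψ) := by
  ext; simp [tensorMap]

/-- The tensor algebra `T(V)` of a `G`-module, on which `G` acts by algebra automorphisms. -/
def TensorAlg (_ρ : Representation ℂ G V) : Type _ := TensorAlgebra ℂ V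

namespace TensorAlg

variable (ρ : Representation ℂ G V)

instance : Ring (TensorAlg ρ) := inferInstanceAs (Ring (TensorAlgebra ℂ V))

instance : Algebra ℂ (TensorAlg ρ) := inferInstanceAs (Algebra ℂ (TensorAlgebra ℂ V))

/-- The identity map from the tensor algebra to its copy that remembers the action. -/
def equiv : TensorAlgebra ℂ V ≃ₐ[ℂ] TensorAlg ρ := (AlgEquiv.refl : TensorAlgebra ℂ V ≃ₐ[ℂ] _)

/-- The algebra endomorphism of `T(V)` that extends the action of `g` on `V`. -/
def act (g : G) : TensorAlg ρ →ₐ[ℂ] TensorAlg ρ :=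
  ((equiv ρ).toAlgHom.comp (tensorMap (ρ g))).comp (equiv ρ).symm.toAlgHom

theorem act_one : act ρ 1 = AlgHom.id ℂ (TensorAlg ρ) :=
  (congrArg tensorMap (map_one ρ)).trans tensorMap_id

theorem act_mul (g h : G) : act ρ (g * h) = (act ρ g).comp (act ρ h) :=
  (congrArg tensorMap (map_mul ρ g h)).trans (tensorMap_comp (ρ g) (ρ h))

instance : MulSemiringAction G (TensorAlg ρ) where
  smul g x := act ρ g x
  one_smul x := congrArg (fun φ : TensorAlg ρ →ₐ[ℂ] TensorAlg ρ => φ x) (act_one ρ)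
  mul_smul g h x := congrArg (fun φ : TensorAlg ρ →ₐ[ℂ] TensorAlg ρ => φ x) (act_mul ρ g h)
  smul_zero g := map_zero (act ρ g)
  smul_add g := map_add (act ρ g)
  smul_one g := map_one (act ρ g)
  smul_mul g := map_mul (act ρ g)

theorem smul_equiv (g : G) (x : TensorAlgebra ℂ V) :
    g • equiv ρ x = equiv ρ (tensorMap (ρ g) x) := rfl

instance : SMulCommClass G ℂ (TensorAlg ρ) where
  smul_comm g c x := map_smul (act ρ g) c x

end TensorAlg

/-- The semidirect product `T(V) ⋊ G`: finite sums `∑ a g` with `a ∈ T(V)` and `g ∈ G`, multiplied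
by `(a g)(b h) = a (g ▹ b) g h`. The element `a g` is `SkewMonoidAlgebra.single g a`. -/
abbrev TensorSemidirect (ρ : Representation ℂ G V) : Type _ := SkewMonoidAlgebra (TensorAlg ρ) G

namespace TensorSemidirect

/-- `a ↦ a ⊗ 1`. -/
def ofTensor (ρ : Representation ℂ G V) : TensorAlgebra ℂ V →ₐ[ℂ] TensorSemidirect ρ :=
  ({ SkewMonoidAlgebra.singleOneRingHom with commutes' := fun _ => rfl } :
    TensorAlg ρ →ₐ[ℂ] SkewMonoidAlgebra (TensorAlg ρ) G).comp (TensorAlg.equiv ρ).toAlgHom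

theorem ofTensor_apply (ρ : Representation ℂ G V) (x : TensorAlgebra ℂ V) :
    ofTensor ρ x = SkewMonoidAlgebra.single 1 (TensorAlg.equiv ρ x) := rfl

/-- The embedding of the group algebra, `g ↦ 1 ⊗ g`. -/
def ofGroupAlgebra (ρ : Representation ℂ G V) : MonoidAlgebra ℂ G →ₐ[ℂ] TensorSemidirect ρ :=
  MonoidAlgebra.lift ℂ (TensorSemidirect ρ) G (SkewMonoidAlgebra.of (TensorAlg ρ) G)

theorem ofGroupAlgebra_of (ρ : Representation ℂ G V) (g : G) :
    ofGroupAlgebra ρ (MonoidAlgebra.of ℂ G g) = SkewMonoidAlgebra.single g 1 := by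
  simp [ofGroupAlgebra]

end TensorSemidirect

end Semidirect

/-! ### Braided doubles -/

section Double

variable {G : Type*} [Group G]
variable {Vm : Type*} [AddCommGroup Vm] [Module ℂ Vm]
variable {Vp : Type*} [AddCommGroup Vp] [Module ℂ Vp]

section Relations

variable (ρm : Representation ℂ G Vm) (ρp : Representation ℂ G Vp)

/-- `T(V⁻) → T(V⁻ ⊕ V⁺) ⋊ G`. -/
def semidirectNeg : TensorAlgebra ℂ Vm →ₐ[ℂ] TensorSemidirect (ρm.prod ρp) :=
  (TensorSemidirect.ofTensor (ρm.prod ρp)).comp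
    (tensorMap (LinearMap.inl ℂ Vm Vp))

/-- `T(V⁺) → T(V⁻ ⊕ V⁺) ⋊ G`. -/
def semidirectPos : TensorAlgebra ℂ Vp →ₐ[ℂ] TensorSemidirect (ρm.prod ρp) :=
  (TensorSemidirect.ofTensor (ρm.prod ρp)).comp
    (tensorMap (LinearMap.inr ℂ Vm Vp))

/-- The defining relations of `A_β(R⁻, R⁺)`: all of `R⁻` and `R⁺`, and `fv - vf = β(f ⊗ v)` for
`f ∈ V⁺`, `v ∈ V⁻`. -/
inductive DoubleRel (β : Vp →ₗ[ℂ] Vm →ₗ[ℂ] MonoidAlgebra ℂ G)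
    (Rm : Submodule ℂ (TensorAlgebra ℂ Vm)) (Rp : Submodule ℂ (TensorAlgebra ℂ Vp)) :
    TensorSemidirect (ρm.prod ρp) → TensorSemidirect (ρm.prod ρp) → Prop
  | neg (x : TensorAlgebra ℂ Vm) (hx : x ∈ Rm) : DoubleRel β Rm Rp (semidirectNeg ρm ρp x) 0
  | pos (x : TensorAlgebra ℂ Vp) (hx : x ∈ Rp) : DoubleRel β Rm Rp (semidirectPos ρm ρp x) 0
  | comm (f : Vp) (v : Vm) : DoubleRel β Rm Rp
      (semidirectPos ρm ρp (TensorAlgebra.ι ℂ f) * semidirectNeg ρm ρp (TensorAlgebra.ι ℂ v) -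
        semidirectNeg ρm ρp (TensorAlgebra.ι ℂ v) * semidirectPos ρm ρp (TensorAlgebra.ι ℂ f))
      (TensorSemidirect.ofGroupAlgebra (ρm.prod ρp) (β f v))

end Relations

variable (ρm : Representation ℂ G Vm) (ρp : Representation ℂ G Vp)
variable (β : Vp →ₗ[ℂ] Vm →ₗ[ℂ] MonoidAlgebra ℂ G)
variable (Rm : Submodule ℂ (TensorAlgebra ℂ Vm)) (Rp : Submodule ℂ (TensorAlgebra ℂ Vp))

/-- The algebra `A_β(R⁻, R⁺)`: the quotient of `T(V⁻ ⊕ V⁺) ⋊ G` by the two-sided ideal that the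
relations generate. -/
abbrev Double : Type _ := RingQuot (DoubleRel ρm ρp β Rm Rp)

namespace Double

/-- The algebra map `T(V⁻) → A_β(R⁻, R⁺)`. -/
def neg : TensorAlgebra ℂ Vm →ₐ[ℂ] Double ρm ρp β Rm Rp :=
  (RingQuot.mkAlgHom ℂ (DoubleRel ρm ρp β Rm Rp)).comp (semidirectNeg ρm ρp)

/-- The algebra map `T(V⁺) → A_β(R⁻, R⁺)`. -/
def pos : TensorAlgebra ℂ Vp →ₐ[ℂ] Double ρm ρp β Rm Rp :=
  (RingQuot.mkAlgHom ℂ (DoubleRel ρm ρp β Rm Rp)).comp (semidirectPos ρm ρp)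

/-- The algebra map `ℂG → A_β(R⁻, R⁺)`. -/
def grp : MonoidAlgebra ℂ G →ₐ[ℂ] Double ρm ρp β Rm Rp :=
  (RingQuot.mkAlgHom ℂ (DoubleRel ρm ρp β Rm Rp)).comp
    (TensorSemidirect.ofGroupAlgebra (ρm.prod ρp))

end Double

/-- `I` is a `G`-invariant graded two-sided ideal of `T(V)` contained in `T^{>0}(V)`, the kernel of
the augmentation `T(V) → ℂ`. -/
structure IsGradedInvariantIdeal {V : Type*} [AddCommGroup V] [Module ℂ V]
    (ρ : Representation ℂ G V) (I : Submodule ℂ (TensorAlgebra ℂ V)) : Prop where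
  mul_mem_left : ∀ a, ∀ x ∈ I, a * x ∈ I
  mul_mem_right : ∀ a, ∀ x ∈ I, x * a ∈ I
  graded : ∀ x ∈ I, ∀ n : ℕ,
    (DirectSum.decompose
      (fun n : ℕ => LinearMap.range (TensorAlgebra.ι ℂ : V →ₗ[ℂ] TensorAlgebra ℂ V) ^ n) x n :
        TensorAlgebra ℂ V) ∈ I
  le_augmentation : ∀ x ∈ I, TensorAlgebra.algebraMapInv x = 0
  invariant : ∀ g : G, ∀ x ∈ I, tensorMap (ρ g) x ∈ I

/-- The condition `[V⁺, I⁻] ⊆ I⁻ ⊗ ℂG` in the free double `A_β(0, 0)`. -/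
def CommutesIntoNeg (I : Submodule ℂ (TensorAlgebra ℂ Vm)) : Prop :=
  ∀ (f : Vp), ∀ x ∈ I,
    Double.pos ρm ρp β ⊥ ⊥ (TensorAlgebra.ι ℂ f) * Double.neg ρm ρp β ⊥ ⊥ x -
      Double.neg ρm ρp β ⊥ ⊥ x * Double.pos ρm ρp β ⊥ ⊥ (TensorAlgebra.ι ℂ f) ∈
    Submodule.span ℂ {z | ∃ a ∈ I, ∃ g : G,
      z = Double.neg ρm ρp β ⊥ ⊥ a * Double.grp ρm ρp β ⊥ ⊥ (MonoidAlgebra.of ℂ G g)}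

/-- The condition `[I⁺, V⁻] ⊆ ℂG ⊗ I⁺` in the free double `A_β(0, 0)`. -/
def CommutesIntoPos (I : Submodule ℂ (TensorAlgebra ℂ Vp)) : Prop :=
  ∀ (v : Vm), ∀ x ∈ I,
    Double.pos ρm ρp β ⊥ ⊥ x * Double.neg ρm ρp β ⊥ ⊥ (TensorAlgebra.ι ℂ v) -
      Double.neg ρm ρp β ⊥ ⊥ (TensorAlgebra.ι ℂ v) * Double.pos ρm ρp β ⊥ ⊥ x ∈
    Submodule.span ℂ {z | ∃ a ∈ I, ∃ g : G,
      z = Double.grp ρm ρp β ⊥ ⊥ (MonoidAlgebra.of ℂ G g) * Double.pos ρm ρp β ⊥ ⊥ a}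

/-- `I_β⁻`: the sum of all `G`-invariant graded ideals `I⁻ ⊆ T^{>0}(V⁻)` with
`[V⁺, I⁻] ⊆ I⁻ ⊗ ℂG`. -/
def maxNegIdeal : Submodule ℂ (TensorAlgebra ℂ Vm) :=
  sSup {I | IsGradedInvariantIdeal ρm I ∧ CommutesIntoNeg ρm ρp β I}

/-- `I_β⁺`: the sum of all `G`-invariant graded ideals `I⁺ ⊆ T^{>0}(V⁺)` with
`[I⁺, V⁻] ⊆ ℂG ⊗ I⁺`. -/
def maxPosIdeal : Submodule ℂ (TensorAlgebra ℂ Vp) :=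
  sSup {I | IsGradedInvariantIdeal ρp I ∧ CommutesIntoPos ρm ρp β I}

/-- The minimal double `A_β(I_β⁻, I_β⁺)`. -/
abbrev MinimalDouble : Type _ :=
  Double ρm ρp β (maxNegIdeal ρm ρp β) (maxPosIdeal ρm ρp β)

end Double

/-! ### Braided Heisenberg doubles -/

section Heisenberg

variable {G : Type*} [Group G] {Y : Type*} [AddCommGroup Y] [Module ℂ Y]

/-- The braided Heisenberg double `H_Y`: the minimal double with `V⁻ = Y`, `V⁺ = Y*` (with the
contragredient action) and `β(f ⊗ v) = ⟨f, v⁽⁰⁾⟩ v⁽¹⁾`. -/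
abbrev HeisenbergDouble (M : YDModule G Y) : Type _ :=
  MinimalDouble M.act M.act.dual M.heisenbergForm

namespace HeisenbergDouble

variable (M : YDModule G Y)

/-- The image of `v ∈ Y` in `H_Y`. -/
def ofY : Y →ₗ[ℂ] HeisenbergDouble M :=
  (Double.neg M.act M.act.dual M.heisenbergForm _ _).toLinearMap ∘ₗ TensorAlgebra.ι ℂ

/-- The image of `f ∈ Y*` in `H_Y`. -/
def ofDual : Module.Dual ℂ Y →ₗ[ℂ] HeisenbergDouble M :=
  (Double.pos M.act M.act.dual M.heisenbergForm _ _).toLinearMap ∘ₗ TensorAlgebra.ι ℂ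

/-- The image of `g ∈ G` in `H_Y`. -/
def ofG : G →* HeisenbergDouble M :=
  (Double.grp M.act M.act.dual M.heisenbergForm
    (maxNegIdeal M.act M.act.dual M.heisenbergForm)
    (maxPosIdeal M.act M.act.dual M.heisenbergForm)).toMonoidHom.comp (MonoidAlgebra.of ℂ G)

/-- The action of `G` on `H_Y` by conjugation, `g ▹ x = g x g⁻¹`. -/
def conj : Representation ℂ G (HeisenbergDouble M) where
  toFun g := LinearMap.mulLeft ℂ (ofG M g) ∘ₗ LinearMap.mulRight ℂ (ofG M g⁻¹)
  map_one' := by ext; simp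
  map_mul' g h := by ext; simp [mul_assoc]

end HeisenbergDouble

end Heisenberg

end

noncomputable section

/-! ### Gradings from coactions -/

section Coaction

variable {G : Type*} [Group G] {V : Type*} [AddCommGroup V] [Module ℂ V]
variable {W : Type*} [AddCommGroup W] [Module ℂ W]

/-! A grading by $G$ is encoded as an algebra map $\Delta\colon A\to A\otimes\mathbb CG$, the
elements of degree $g$ being those with $\Delta x=x\otimes g$. Such subspaces are always independent
and multiply correctly, and they span once $A$ is generated by sums of homogeneous elements
(`iSup_degreePart_eq_top`). Neither coassociativity nor a counit has to be checked.

For a double on $Y$ and $Y^*$, $\Delta$ comes from the universal property: $v\mapsto v\otimes g$ on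
$Y_g$, $f\mapsto f\otimes1$, $g\mapsto g\otimes g$. The cross relation is homogeneous, since $fv-vf$
and $\langle f,v\rangle g$ both have degree $g$; relations in $T(Y^*)$ have degree $1$. Only $R^-$
imposes a condition: it must be spanned by homogeneous elements (`semidirectLift_rel`).

For $R^-=I_\beta^-$ this follows from maximality. If $I$ is an admissible ideal, so is the span of
the $G$-components of its elements. The delicate point is $[V^+,I]\subset I\cdot\mathbb CG$
(`CommutesIntoNeg.homogeneousSpan`): the free double is itself graded and $V^+$ has degree $1$
there, so the commutator with $f$ commutes with the projections. Hence the components of $I$ lie in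
$I_\beta^-$ (`maxNegIdeal_le_iSup_inf_tensorDegree`).

The Yetter–Drinfeld condition is then automatic, because $g$ has degree $g$ and acts by conjugation.
-/

/-- The subspace of elements of degree `g` for a linear map `δ : V → V ⊗ ℂG`. -/
def degreePart (δ : V →ₗ[ℂ] V ⊗[ℂ] MonoidAlgebra ℂ G) (g : G) : Submodule ℂ V :=
  LinearMap.eqLocus δ ((TensorProduct.mk ℂ V (MonoidAlgebra ℂ G)).flip (MonoidAlgebra.of ℂ G g))

theorem mem_degreePart {δ : V →ₗ[ℂ] V ⊗[ℂ] MonoidAlgebra ℂ G} {g : G} {x : V} :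
    x ∈ degreePart δ g ↔ δ x = x ⊗ₜ MonoidAlgebra.of ℂ G g :=
  Iff.rfl

/-- The coefficient of `g` in an element of `V ⊗ ℂG`. -/
def tensorCoeff (V : Type*) [AddCommGroup V] [Module ℂ V] (g : G) :
    V ⊗[ℂ] MonoidAlgebra ℂ G →ₗ[ℂ] V :=
  (TensorProduct.rid ℂ V).toLinearMap ∘ₗ LinearMap.lTensor V
    ((Finsupp.lapply g) ∘ₗ (MonoidAlgebra.coeffLinearEquiv ℂ).toLinearMap)

open Classical in
theorem tensorCoeff_tmul_of (g h : G) (v : V) :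
    tensorCoeff V g (v ⊗ₜ MonoidAlgebra.of ℂ G h) = if h = g then v else 0 := by
  by_cases hk : h = g
  · subst hk; simp [tensorCoeff]
  · simp [tensorCoeff, hk]

-- Naturality: $\varphi$ and the coefficient functional act on different tensor factors. It serves
-- to move the augmentation past a projection.
omit [Group G] in
theorem map_tensorCoeff (φ : V →ₗ[ℂ] W) (g : G) (t : V ⊗[ℂ] MonoidAlgebra ℂ G) :
    φ (tensorCoeff V g t) = tensorCoeff W g (LinearMap.rTensor _ φ t) := by
  induction t with
  | zero => simp
  | add a b ha hb => simp [ha, hb]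
  | tmul a b => simp [tensorCoeff]

/-- The projection to the component of degree `g`. -/
def degreeProj (δ : V →ₗ[ℂ] V ⊗[ℂ] MonoidAlgebra ℂ G) (g : G) : V →ₗ[ℂ] V :=
  tensorCoeff V g ∘ₗ δ

theorem degreeProj_of_mem (δ : V →ₗ[ℂ] V ⊗[ℂ] MonoidAlgebra ℂ G) {g : G} {x : V}
    (hx : x ∈ degreePart δ g) : degreeProj δ g x = x := by
  rw [degreeProj, LinearMap.comp_apply, mem_degreePart.1 hx, tensorCoeff_tmul_of, if_pos rfl]

theorem degreeProj_of_mem_of_ne (δ : V →ₗ[ℂ] V ⊗[ℂ] MonoidAlgebra ℂ G) {g h : G} {x : V}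
    (hx : x ∈ degreePart δ h) (hne : h ≠ g) : degreeProj δ g x = 0 := by
  rw [degreeProj, LinearMap.comp_apply, mem_degreePart.1 hx, tensorCoeff_tmul_of, if_neg hne]

theorem iSupIndep_degreePart (δ : V →ₗ[ℂ] V ⊗[ℂ] MonoidAlgebra ℂ G) :
    iSupIndep (degreePart δ) :=
  YDModule.iSupIndep_of_coaction _ δ fun _ _ hv => hv

/-- Two linear maps that agree on a family of subspaces with sum `V` are equal. -/
theorem linearMap_ext_of_iSup_eq_top {ι : Type*} {p : ι → Submodule ℂ V} (hp : ⨆ i, p i = ⊤)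
    {φ ψ : V →ₗ[ℂ] W} (h : ∀ i, ∀ x ∈ p i, φ x = ψ x) : φ = ψ := by
  have h0 : (⨆ i, p i) ≤ LinearMap.eqLocus φ ψ := iSup_le fun i x hx => h i x hx
  rw [hp] at h0
  exact LinearMap.ext fun x => h0 Submodule.mem_top

/-- A linear map that sends degree `h` to degree `σ h`, with `σ` injective, intertwines the
projections. -/
theorem map_degreeProj {δ : V →ₗ[ℂ] V ⊗[ℂ] MonoidAlgebra ℂ G}
    {δ' : W →ₗ[ℂ] W ⊗[ℂ] MonoidAlgebra ℂ G} (htop : ⨆ g, degreePart δ g = ⊤)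
    (φ : V →ₗ[ℂ] W) {σ : G → G} (hσ : Function.Injective σ)
    (hφ : ∀ h, ∀ x ∈ degreePart δ h, φ x ∈ degreePart δ' (σ h)) (g : G) (x : V) :
    φ (degreeProj δ g x) = degreeProj δ' (σ g) (φ x) := by
  have : φ ∘ₗ degreeProj δ g = degreeProj δ' (σ g) ∘ₗ φ := by
    refine linearMap_ext_of_iSup_eq_top htop fun h y hy => ?_
    rw [LinearMap.comp_apply, LinearMap.comp_apply]
    by_cases hg : h = g
    · subst hg
      rw [degreeProj_of_mem δ hy, degreeProj_of_mem δ' (hφ h y hy)]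
    -- Injectivity of `σ` keeps distinct degrees distinct, so both sides vanish.
    · rw [degreeProj_of_mem_of_ne δ hy hg, degreeProj_of_mem_of_ne δ' (hφ h y hy) (hσ.ne hg),
        map_zero]
  exact LinearMap.congr_fun this x

/-- Coassociativity would usually give this; here spanning replaces it, since the claim is clear on
each homogeneous element. -/
theorem degreeProj_mem {δ : V →ₗ[ℂ] V ⊗[ℂ] MonoidAlgebra ℂ G} (htop : ⨆ g, degreePart δ g = ⊤)
    (g : G) (x : V) : degreeProj δ g x ∈ degreePart δ g := by
  have h0 : (⨆ h, degreePart δ h) ≤ (degreePart δ g).comap (degreeProj δ g) := by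
    refine iSup_le fun h y hy => ?_
    rw [Submodule.mem_comap]
    by_cases hg : h = g
    · subst hg
      rwa [degreeProj_of_mem δ hy]
    · rw [degreeProj_of_mem_of_ne δ hy hg]
      exact zero_mem _
  rw [htop] at h0
  exact h0 Submodule.mem_top

/-- An element is the sum of its finitely many nonzero components. `I` need not contain them; this
is what lets an arbitrary ideal be enlarged to a homogeneous one. -/
theorem mem_iSup_map_degreeProj {δ : V →ₗ[ℂ] V ⊗[ℂ] MonoidAlgebra ℂ G}
    (htop : ⨆ g, degreePart δ g = ⊤) (I : Submodule ℂ V) {x : V} (hx : x ∈ I) :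
    x ∈ ⨆ g, I.map (degreeProj δ g) := by
  have key : ∀ y ∈ ⨆ h, degreePart δ h, ∃ s : Finset G, ∑ g ∈ s, degreeProj δ g y = y := by
    classical
    intro y hy
    obtain ⟨f, hf⟩ := (Submodule.mem_iSup_iff_exists_dfinsupp' _ _).1 hy
    refine ⟨f.support, ?_⟩
    conv_rhs => rw [← hf, DFinsupp.sum]
    refine Finset.sum_congr rfl fun g _ => ?_
    rw [← hf, DFinsupp.sum, map_sum, Finset.sum_eq_single g]
    · exact degreeProj_of_mem δ (f g).2
    · exact fun h _ hg => degreeProj_of_mem_of_ne δ (f h).2 hg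
    · intro hg
      rw [DFinsupp.notMem_support_iff.1 hg]
      simp
  obtain ⟨s, hs⟩ := key x (htop ▸ Submodule.mem_top)
  rw [← hs]
  exact sum_mem fun g _ => Submodule.mem_iSup_of_mem g (Submodule.mem_map_of_mem hx)

end Coaction

section CoactionAlg

variable {G : Type*} [Group G] {A : Type*} [Ring A] [Algebra ℂ A]
variable (Δ : A →ₐ[ℂ] A ⊗[ℂ] MonoidAlgebra ℂ G)

theorem one_mem_degreePart : (1 : A) ∈ degreePart Δ.toLinearMap (1 : G) := by
  rw [mem_degreePart, AlgHom.toLinearMap_apply, map_one, map_one,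
    Algebra.TensorProduct.one_def]

theorem algebraMap_mem_degreePart (c : ℂ) :
    algebraMap ℂ A c ∈ degreePart Δ.toLinearMap (1 : G) := by
  rw [Algebra.algebraMap_eq_smul_one]
  exact Submodule.smul_mem _ _ (one_mem_degreePart Δ)

theorem mul_mem_degreePart {g h : G} {x y : A} (hx : x ∈ degreePart Δ.toLinearMap g)
    (hy : y ∈ degreePart Δ.toLinearMap h) : x * y ∈ degreePart Δ.toLinearMap (g * h) := by
  rw [mem_degreePart, AlgHom.toLinearMap_apply] at *
  rw [map_mul, hx, hy, Algebra.TensorProduct.tmul_mul_tmul, map_mul]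

/-- The homogeneous elements span as soon as they generate. -/
theorem iSup_degreePart_eq_top {s : Set A} (hs : Algebra.adjoin ℂ s = ⊤)
    (h : ∀ x ∈ s, x ∈ ⨆ g, degreePart Δ.toLinearMap g) :
    ⨆ g, degreePart Δ.toLinearMap g = ⊤ := by
  have hmul : ∀ x ∈ ⨆ g, degreePart Δ.toLinearMap g, ∀ y ∈ ⨆ g, degreePart Δ.toLinearMap g,
      x * y ∈ ⨆ g, degreePart Δ.toLinearMap g := by
    intro x hx y hy
    -- Writing the product through `map₂` distributes it over both suprema.
    have := Submodule.apply_mem_map₂ (LinearMap.mul ℂ A) hx hy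
    rw [Submodule.map₂_iSup_left] at this
    simp_rw [Submodule.map₂_iSup_right] at this
    refine (iSup₂_le fun g k => Submodule.map₂_le.2 fun a ha b hb => ?_ :
      (⨆ g, ⨆ k, Submodule.map₂ (LinearMap.mul ℂ A) (degreePart Δ.toLinearMap g)
        (degreePart Δ.toLinearMap k)) ≤ _) this
    exact Submodule.mem_iSup_of_mem (g * k) (mul_mem_degreePart Δ ha hb)
  rw [eq_top_iff]
  intro x _
  have hx : x ∈ Algebra.adjoin ℂ s := hs ▸ Algebra.mem_top
  induction hx using Algebra.adjoin_induction with
  | mem x hx => exact h x hx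
  | algebraMap c => exact Submodule.mem_iSup_of_mem 1 (algebraMap_mem_degreePart Δ c)
  | add x y _ _ hx hy => exact add_mem (hx trivial) (hy trivial)
  | mul x y _ _ hx hy => exact hmul x (hx trivial) y (hy trivial)

/-! ### Projections and multiplication by homogeneous elements -/

variable {Δ}

/-- Multiplication by a homogeneous element translates degrees, and translations of a group are
injective. -/
theorem mul_degreeProj (htop : ⨆ g, degreePart Δ.toLinearMap g = ⊤)
    {h : G} {a : A} (ha : a ∈ degreePart Δ.toLinearMap h) (g : G) (x : A) :
    a * degreeProj Δ.toLinearMap g x = degreeProj Δ.toLinearMap (h * g) (a * x) :=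
  map_degreeProj htop (LinearMap.mulLeft ℂ a) (mul_right_injective h)
    (fun _ _ hx => mul_mem_degreePart Δ ha hx) g x

theorem degreeProj_mul (htop : ⨆ g, degreePart Δ.toLinearMap g = ⊤)
    {h : G} {a : A} (ha : a ∈ degreePart Δ.toLinearMap h) (g : G) (x : A) :
    degreeProj Δ.toLinearMap g x * a = degreeProj Δ.toLinearMap (g * h) (x * a) :=
  map_degreeProj htop (LinearMap.mulRight ℂ a) (mul_left_injective h)
    (fun _ _ hx => mul_mem_degreePart Δ hx ha) g x

end CoactionAlg
end

noncomputable section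

/-! ### The coaction on the tensor algebra and on doubles -/

section DoubleCoaction

variable {G : Type*} [Group G] {Y : Type*} [AddCommGroup Y] [Module ℂ Y] (M : YDModule G Y)

/-- Reduces identities linear in $v\in Y$ to homogeneous $v$, where the coaction is explicit. -/
theorem YDModule.ext_of_gr {W : Type*} [AddCommGroup W] [Module ℂ W] {φ ψ : Y →ₗ[ℂ] W}
    (h : ∀ g, ∀ v ∈ M.gr g, φ v = ψ v) : φ = ψ :=
  linearMap_ext_of_iSup_eq_top M.iSup_eq_top h

theorem YDModule.act_mem (g : G) {h : G} {v : Y} (hv : v ∈ M.gr h) :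
    M.act g v ∈ M.gr (g * h * g⁻¹) :=
  M.compat g h ▸ Submodule.mem_map_of_mem hv

theorem YDModule.rTensor_coaction_of_mem {W : Type*} [AddCommGroup W] [Module ℂ W]
    (φ : Y →ₗ[ℂ] W) {g : G} {v : Y} (hv : v ∈ M.gr g) :
    LinearMap.rTensor _ φ (M.coaction v) = φ v ⊗ₜ MonoidAlgebra.of ℂ G g := by
  rw [M.coaction_of_mem hv, LinearMap.rTensor_tmul]

/-- The coaction of `ℂG` on `T(Y)`. -/
def tensorCoaction : TensorAlgebra ℂ Y →ₐ[ℂ] TensorAlgebra ℂ Y ⊗[ℂ] MonoidAlgebra ℂ G :=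
  TensorAlgebra.lift ℂ (LinearMap.rTensor _ (TensorAlgebra.ι ℂ) ∘ₗ M.coaction)

theorem tensorCoaction_ι (v : Y) : tensorCoaction M (TensorAlgebra.ι ℂ v) =
    LinearMap.rTensor _ (TensorAlgebra.ι ℂ) (M.coaction v) := by
  simp [tensorCoaction]

/-- The component of `T(Y)` of degree `g`. -/
abbrev tensorDegree (g : G) : Submodule ℂ (TensorAlgebra ℂ Y) :=
  degreePart (tensorCoaction M).toLinearMap g

/-- The projection of `T(Y)` to its component of degree `g`. -/
abbrev tensorProj (g : G) : TensorAlgebra ℂ Y →ₗ[ℂ] TensorAlgebra ℂ Y :=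
  degreeProj (tensorCoaction M).toLinearMap g

theorem ι_mem_tensorDegree {g : G} {v : Y} (hv : v ∈ M.gr g) :
    TensorAlgebra.ι ℂ v ∈ tensorDegree M g := by
  rw [mem_degreePart, AlgHom.toLinearMap_apply, tensorCoaction_ι, M.rTensor_coaction_of_mem _ hv]

theorem iSup_tensorDegree : ⨆ g, tensorDegree M g = ⊤ := by
  refine iSup_degreePart_eq_top _ TensorAlgebra.adjoin_range_ι ?_
  rintro _ ⟨v, rfl⟩
  have h0 : (⨆ g, M.gr g) ≤ (⨆ g, tensorDegree M g).comap (TensorAlgebra.ι ℂ) :=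
    iSup_le fun g w hw => Submodule.mem_iSup_of_mem g (ι_mem_tensorDegree M hw)
  rw [M.iSup_eq_top] at h0
  exact h0 Submodule.mem_top

namespace Double

/-! ### Relations and generators of a general double -/

section Generators

variable {Vm : Type*} [AddCommGroup Vm] [Module ℂ Vm] {Vp : Type*} [AddCommGroup Vp] [Module ℂ Vp]
variable (ρm : Representation ℂ G Vm) (ρp : Representation ℂ G Vp)
variable (β : Vp →ₗ[ℂ] Vm →ₗ[ℂ] MonoidAlgebra ℂ G)
variable (Rm : Submodule ℂ (TensorAlgebra ℂ Vm)) (Rp : Submodule ℂ (TensorAlgebra ℂ Vp))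

/-- This is $ga=(g\triangleright a)g$, which already holds in the semidirect product. -/
theorem grp_mul_neg (g : G) (v : Vm) :
    grp ρm ρp β Rm Rp (MonoidAlgebra.of ℂ G g) * neg ρm ρp β Rm Rp (TensorAlgebra.ι ℂ v) =
      neg ρm ρp β Rm Rp (TensorAlgebra.ι ℂ (ρm g v)) *
        grp ρm ρp β Rm Rp (MonoidAlgebra.of ℂ G g) := by
  simp only [grp, neg, AlgHom.comp_apply, TensorSemidirect.ofGroupAlgebra_of, semidirectNeg,
    TensorSemidirect.ofTensor_apply, ← map_mul, SkewMonoidAlgebra.single_mul_single,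
    TensorAlg.smul_equiv]
  simp [tensorMap]

theorem grp_mul_pos (g : G) (f : Vp) :
    grp ρm ρp β Rm Rp (MonoidAlgebra.of ℂ G g) * pos ρm ρp β Rm Rp (TensorAlgebra.ι ℂ f) =
      pos ρm ρp β Rm Rp (TensorAlgebra.ι ℂ (ρp g f)) *
        grp ρm ρp β Rm Rp (MonoidAlgebra.of ℂ G g) := by
  simp only [grp, pos, AlgHom.comp_apply, TensorSemidirect.ofGroupAlgebra_of, semidirectPos,
    TensorSemidirect.ofTensor_apply, ← map_mul, SkewMonoidAlgebra.single_mul_single,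
    TensorAlg.smul_equiv]
  simp [tensorMap]

theorem comm (f : Vp) (v : Vm) :
    pos ρm ρp β Rm Rp (TensorAlgebra.ι ℂ f) * neg ρm ρp β Rm Rp (TensorAlgebra.ι ℂ v) -
      neg ρm ρp β Rm Rp (TensorAlgebra.ι ℂ v) * pos ρm ρp β Rm Rp (TensorAlgebra.ι ℂ f) =
      grp ρm ρp β Rm Rp (β f v) := by
  have := RingQuot.mkAlgHom_rel ℂ (DoubleRel.comm (ρm := ρm) (ρp := ρp) (β := β) (Rm := Rm)
    (Rp := Rp) f v)
  simp only [map_sub, map_mul] at this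
  exact this

theorem neg_eq_zero {x : TensorAlgebra ℂ Vm} (hx : x ∈ Rm) : neg ρm ρp β Rm Rp x = 0 := by
  have := RingQuot.mkAlgHom_rel ℂ (DoubleRel.neg (ρm := ρm) (ρp := ρp) (β := β) (Rm := Rm)
    (Rp := Rp) x hx)
  rw [map_zero] at this
  exact this

theorem pos_eq_zero {x : TensorAlgebra ℂ Vp} (hx : x ∈ Rp) : pos ρm ρp β Rm Rp x = 0 := by
  have := RingQuot.mkAlgHom_rel ℂ (DoubleRel.pos (ρm := ρm) (ρp := ρp) (β := β) (Rm := Rm)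
    (Rp := Rp) x hx)
  rw [map_zero] at this
  exact this

/-- The double is generated by `V⁻`, `V⁺` and `G`. -/
theorem adjoin_generators :
    Algebra.adjoin ℂ (Set.range (fun v => neg ρm ρp β Rm Rp (TensorAlgebra.ι ℂ v)) ∪
      Set.range (fun f => pos ρm ρp β Rm Rp (TensorAlgebra.ι ℂ f)) ∪
      Set.range (fun g => grp ρm ρp β Rm Rp (MonoidAlgebra.of ℂ G g))) = ⊤ := by
  set S := Algebra.adjoin ℂ (Set.range (fun v => neg ρm ρp β Rm Rp (TensorAlgebra.ι ℂ v)) ∪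
      Set.range (fun f => pos ρm ρp β Rm Rp (TensorAlgebra.ι ℂ f)) ∪
      Set.range (fun g => grp ρm ρp β Rm Rp (MonoidAlgebra.of ℂ G g))) with hS
  let π := RingQuot.mkAlgHom ℂ (DoubleRel ρm ρp β Rm Rp)
  have hT : ∀ a : TensorAlgebra ℂ (Vm × Vp),
      π (TensorSemidirect.ofTensor (ρm.prod ρp) a) ∈ S := by
    intro a
    have ha : a ∈ Algebra.adjoin ℂ (Set.range (TensorAlgebra.ι ℂ (M := Vm × Vp))) :=
      TensorAlgebra.adjoin_range_ι (R := ℂ) (M := Vm × Vp) ▸ Algebra.mem_top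
    induction ha using Algebra.adjoin_induction with
    | mem x hx =>
      obtain ⟨⟨v, f⟩, rfl⟩ := hx
      have e : π (TensorSemidirect.ofTensor (ρm.prod ρp) (TensorAlgebra.ι ℂ (v, f))) =
          neg ρm ρp β Rm Rp (TensorAlgebra.ι ℂ v) + pos ρm ρp β Rm Rp (TensorAlgebra.ι ℂ f) := by
        simp only [neg, pos, semidirectNeg, semidirectPos, AlgHom.comp_apply, tensorMap,
          TensorAlgebra.lift_ι_apply, LinearMap.comp_apply, LinearMap.inl_apply,
          LinearMap.inr_apply, ← map_add, Prod.mk_add_mk, add_zero, zero_add]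
        rfl
      rw [e]
      exact add_mem (Algebra.subset_adjoin (Or.inl (Or.inl ⟨v, rfl⟩)))
        (Algebra.subset_adjoin (Or.inl (Or.inr ⟨f, rfl⟩)))
    | algebraMap c => rw [AlgHom.commutes, AlgHom.commutes]; exact Subalgebra.algebraMap_mem S c
    | add x y _ _ hx hy => rw [map_add, map_add]; exact add_mem hx hy
    | mul x y _ _ hx hy => rw [map_mul, map_mul]; exact mul_mem hx hy
  rw [eq_top_iff]
  intro x _
  obtain ⟨y, rfl⟩ := RingQuot.mkAlgHom_surjective ℂ (DoubleRel ρm ρp β Rm Rp) x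
  induction y using SkewMonoidAlgebra.induction_on with
  | zero => rw [map_zero]; exact zero_mem S
  | single g a =>
    -- A monomial factors as $a\cdot g$, so the tensor part and the group part can be treated
    -- separately.
    have e : SkewMonoidAlgebra.single g a =
        TensorSemidirect.ofTensor (ρm.prod ρp) ((TensorAlg.equiv _).symm a) *
          TensorSemidirect.ofGroupAlgebra (ρm.prod ρp) (MonoidAlgebra.of ℂ G g) := by
      rw [TensorSemidirect.ofTensor_apply, TensorSemidirect.ofGroupAlgebra_of,
        SkewMonoidAlgebra.single_mul_single]
      simp
    rw [e, map_mul]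
    exact mul_mem (hT _) (Algebra.subset_adjoin (Or.inr ⟨g, rfl⟩))
  | add x y hx hy => rw [map_add]; exact add_mem (hx trivial) (hy trivial)

end Generators

/-! ### The coaction on a double, by the universal property -/

variable (Rm : Submodule ℂ (TensorAlgebra ℂ Y))
variable (Rp : Submodule ℂ (TensorAlgebra ℂ (Module.Dual ℂ Y)))

/-- The double `A_β(R⁻, R⁺)` for `V⁻ = Y`, `V⁺ = Y*` and the form `β` of the Heisenberg double. -/
abbrev Heis : Type _ := Double M.act M.act.dual M.heisenbergForm Rm Rp

/-- The algebra map from `T(Y)` to the double. -/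
abbrev hneg : TensorAlgebra ℂ Y →ₐ[ℂ] Heis M Rm Rp := neg _ _ _ _ _

/-- The algebra map from `T(Y*)` to the double. -/
abbrev hpos : TensorAlgebra ℂ (Module.Dual ℂ Y) →ₐ[ℂ] Heis M Rm Rp := pos _ _ _ _ _

/-- The algebra map from `ℂG` to the double. -/
abbrev hgrp : MonoidAlgebra ℂ G →ₐ[ℂ] Heis M Rm Rp := grp _ _ _ _ _

/-- The coaction on `T(Y ⊕ Y*)`, with values in a double. -/
def tensorLift : TensorAlgebra ℂ (Y × Module.Dual ℂ Y) →ₐ[ℂ]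
    Heis M Rm Rp ⊗[ℂ] MonoidAlgebra ℂ G :=
  TensorAlgebra.lift ℂ (LinearMap.coprod
    (LinearMap.rTensor _ ((hneg M Rm Rp).toLinearMap ∘ₗ TensorAlgebra.ι ℂ) ∘ₗ M.coaction)
    ((TensorProduct.mk ℂ _ (MonoidAlgebra ℂ G)).flip 1 ∘ₗ
      ((hpos M Rm Rp).toLinearMap ∘ₗ TensorAlgebra.ι ℂ)))

/-- The coaction on `G`, with values in a double. -/
def groupLift : G →* Heis M Rm Rp ⊗[ℂ] MonoidAlgebra ℂ G where
  toFun g := hgrp M Rm Rp (MonoidAlgebra.of ℂ G g) ⊗ₜ MonoidAlgebra.of ℂ G g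
  map_one' := by rw [map_one, map_one, Algebra.TensorProduct.one_def]
  map_mul' g h := by rw [map_mul, map_mul, Algebra.TensorProduct.tmul_mul_tmul]

theorem groupLift_apply (g : G) : groupLift M Rm Rp g =
    hgrp M Rm Rp (MonoidAlgebra.of ℂ G g) ⊗ₜ MonoidAlgebra.of ℂ G g := rfl

theorem tensorLift_inl {g : G} {v : Y} (hv : v ∈ M.gr g) :
    tensorLift M Rm Rp (TensorAlgebra.ι ℂ (v, 0)) =
      hneg M Rm Rp (TensorAlgebra.ι ℂ v) ⊗ₜ MonoidAlgebra.of ℂ G g := by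
  simp only [tensorLift, TensorAlgebra.lift_ι_apply, LinearMap.coprod_apply, map_zero, add_zero]
  exact M.rTensor_coaction_of_mem _ hv

theorem tensorLift_inr (f : Module.Dual ℂ Y) :
    tensorLift M Rm Rp (TensorAlgebra.ι ℂ (0, f)) = hpos M Rm Rp (TensorAlgebra.ι ℂ f) ⊗ₜ 1 := by
  simp [tensorLift]

theorem ι_mk_eq_add (v : Y) (f : Module.Dual ℂ Y) :
    TensorAlgebra.ι ℂ (v, f) = TensorAlgebra.ι ℂ (v, 0) + TensorAlgebra.ι ℂ (0, f) := by
  rw [← map_add, Prod.mk_add_mk, add_zero, zero_add]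

/-- The condition for the two lifts to glue on the semidirect product. For $v\in Y_h$ it reduces to
$(ghg^{-1})g=gh$, which is where the Yetter–Drinfeld condition on $Y$ enters; $Y^*$ has degree $1$
and causes no shift. -/
theorem groupLift_comm (g : G) (x : TensorAlgebra ℂ (Y × Module.Dual ℂ Y)) :
    tensorLift M Rm Rp (tensorMap (M.act.prod M.act.dual g) x) * groupLift M Rm Rp g =
      groupLift M Rm Rp g * tensorLift M Rm Rp x := by
  have hx : x ∈ Algebra.adjoin ℂ (Set.range (TensorAlgebra.ι ℂ (M := Y × Module.Dual ℂ Y))) :=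
    TensorAlgebra.adjoin_range_ι (R := ℂ) (M := Y × Module.Dual ℂ Y) ▸ Algebra.mem_top
  induction hx using Algebra.adjoin_induction with
  | mem x hx =>
    obtain ⟨⟨v, f⟩, rfl⟩ := hx
    rw [ι_mk_eq_add, map_add, map_add, map_add, add_mul, mul_add]
    congr 1
    · have := M.ext_of_gr (W := Heis M Rm Rp ⊗[ℂ] MonoidAlgebra ℂ G)
        (φ := LinearMap.mulRight ℂ (groupLift M Rm Rp g) ∘ₗ (tensorLift M Rm Rp).toLinearMap ∘ₗ
          TensorAlgebra.ι ℂ ∘ₗ LinearMap.inl ℂ _ _ ∘ₗ M.act g)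
        (ψ := LinearMap.mulLeft ℂ (groupLift M Rm Rp g) ∘ₗ (tensorLift M Rm Rp).toLinearMap ∘ₗ
          TensorAlgebra.ι ℂ ∘ₗ LinearMap.inl ℂ _ _) ?_
      · have := LinearMap.congr_fun this v
        simpa [tensorMap] using this
      · intro h w hw
        simp only [LinearMap.comp_apply, LinearMap.mulLeft_apply, LinearMap.mulRight_apply,
          LinearMap.inl_apply, AlgHom.toLinearMap_apply, tensorLift_inl _ _ _ hw,
          tensorLift_inl _ _ _ (M.act_mem g hw), groupLift_apply,
          Algebra.TensorProduct.tmul_mul_tmul, grp_mul_neg, ← map_mul]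
        simp
    · simp only [tensorMap, TensorAlgebra.lift_ι_apply, LinearMap.comp_apply]
      have : (M.act.prod M.act.dual g) (0, f) = (0, M.act.dual g f) := by simp
      rw [this, tensorLift_inr, tensorLift_inr, groupLift_apply,
        Algebra.TensorProduct.tmul_mul_tmul, Algebra.TensorProduct.tmul_mul_tmul, grp_mul_pos,
        one_mul, mul_one]
  | algebraMap c => simp only [AlgHom.commutes]; exact Algebra.commutes c _
  | add x y _ _ hx hy => rw [map_add, map_add, map_add, add_mul, mul_add, hx, hy]
  | mul x y _ _ hx hy => rw [map_mul, map_mul, map_mul, mul_assoc, hy, ← mul_assoc, hx, mul_assoc]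

/-- The coaction on `T(Y ⊕ Y*) ⋊ G`, with values in a double. -/
def semidirectLift : TensorSemidirect (M.act.prod M.act.dual) →ₐ[ℂ]
    Heis M Rm Rp ⊗[ℂ] MonoidAlgebra ℂ G :=
  SkewMonoidAlgebra.liftNCAlgHom
    ((tensorLift M Rm Rp).comp (TensorAlg.equiv (M.act.prod M.act.dual)).symm.toAlgHom)
    (groupLift M Rm Rp) (fun {x y} => groupLift_comm M Rm Rp y x)

theorem semidirectLift_single (g : G) (a : TensorAlg (M.act.prod M.act.dual)) :
    semidirectLift M Rm Rp (SkewMonoidAlgebra.single g a) =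
      tensorLift M Rm Rp ((TensorAlg.equiv _).symm a) * groupLift M Rm Rp g :=
  SkewMonoidAlgebra.liftNC_single _ _ _ _

theorem semidirectLift_ofTensor (x : TensorAlgebra ℂ (Y × Module.Dual ℂ Y)) :
    semidirectLift M Rm Rp (TensorSemidirect.ofTensor _ x) = tensorLift M Rm Rp x := by
  rw [TensorSemidirect.ofTensor_apply, semidirectLift_single, map_one, mul_one,
    AlgEquiv.symm_apply_apply]

theorem semidirectLift_of (g : G) :
    semidirectLift M Rm Rp (TensorSemidirect.ofGroupAlgebra _ (MonoidAlgebra.of ℂ G g)) =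
      groupLift M Rm Rp g := by
  rw [TensorSemidirect.ofGroupAlgebra_of, semidirectLift_single, map_one, map_one, one_mul]

/-- Ties the lift to the intrinsic grading of $T(Y)$, so that homogeneity of $R^-$ can be tested
there. -/
theorem semidirectLift_neg (x : TensorAlgebra ℂ Y) :
    semidirectLift M Rm Rp (semidirectNeg _ _ x) =
      Algebra.TensorProduct.map (hneg M Rm Rp) (AlgHom.id ℂ _) (tensorCoaction M x) := by
  have : (semidirectLift M Rm Rp).comp (semidirectNeg _ _) =
      (Algebra.TensorProduct.map (hneg M Rm Rp) (AlgHom.id ℂ _)).comp (tensorCoaction M) := by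
    refine TensorAlgebra.hom_ext ?_
    refine M.ext_of_gr (W := Heis M Rm Rp ⊗[ℂ] MonoidAlgebra ℂ G) fun g v hv => ?_
    simp only [LinearMap.comp_apply, AlgHom.toLinearMap_apply, AlgHom.comp_apply, semidirectNeg,
      semidirectLift_ofTensor, tensorMap, TensorAlgebra.lift_ι_apply, LinearMap.inl_apply,
      tensorLift_inl M Rm Rp hv, tensorCoaction_ι, M.rTensor_coaction_of_mem _ hv,
      Algebra.TensorProduct.map_tmul, AlgHom.id_apply]
  exact DFunLike.congr_fun this x

theorem semidirectLift_pos (x : TensorAlgebra ℂ (Module.Dual ℂ Y)) :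
    semidirectLift M Rm Rp (semidirectPos _ _ x) = hpos M Rm Rp x ⊗ₜ 1 := by
  have : (semidirectLift M Rm Rp).comp (semidirectPos _ _) =
      Algebra.TensorProduct.includeLeft.comp (hpos M Rm Rp) := by
    refine TensorAlgebra.hom_ext (LinearMap.ext fun f => ?_)
    simp only [LinearMap.comp_apply, AlgHom.toLinearMap_apply, AlgHom.comp_apply, semidirectPos,
      semidirectLift_ofTensor, tensorMap, TensorAlgebra.lift_ι_apply, LinearMap.inr_apply,
      tensorLift_inr, Algebra.TensorProduct.includeLeft_apply]
  exact DFunLike.congr_fun this x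

variable {Rm}

theorem semidirectLift_rel (hRm : Rm ≤ ⨆ g, Rm ⊓ tensorDegree M g)
    {x y : TensorSemidirect (M.act.prod M.act.dual)}
    (h : DoubleRel M.act M.act.dual M.heisenbergForm Rm Rp x y) :
    semidirectLift M Rm Rp x = semidirectLift M Rm Rp y := by
  cases h with
  | neg x hx =>
    rw [map_zero, semidirectLift_neg]
    -- A homogeneous $y\in R^-$ goes to $y\otimes g$, whose first factor vanishes in the double.
    have h0 : (⨆ g, Rm ⊓ tensorDegree M g) ≤ LinearMap.ker
        ((Algebra.TensorProduct.map (hneg M Rm Rp) (AlgHom.id ℂ _)).comp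
          (tensorCoaction M)).toLinearMap := by
      refine iSup_le fun g y hy => ?_
      have e : tensorCoaction M y = y ⊗ₜ MonoidAlgebra.of ℂ G g := hy.2
      rw [LinearMap.mem_ker, AlgHom.toLinearMap_apply, AlgHom.comp_apply, e,
        Algebra.TensorProduct.map_tmul, hneg, neg_eq_zero _ _ _ _ _ hy.1, TensorProduct.zero_tmul]
    exact h0 (hRm hx)
  | pos x hx =>
    rw [map_zero, semidirectLift_pos, hpos, pos_eq_zero _ _ _ _ _ hx, TensorProduct.zero_tmul]
  | comm f v =>
    -- The relation is linear in `v`; for $w\in Y_g$ both sides are $f(w)\,g\otimes g$.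
    have := M.ext_of_gr (W := Heis M Rm Rp ⊗[ℂ] MonoidAlgebra ℂ G)
      (φ := (semidirectLift M Rm Rp).toLinearMap ∘ₗ
        (LinearMap.mulLeft ℂ (semidirectPos M.act M.act.dual (TensorAlgebra.ι ℂ f)) -
          LinearMap.mulRight ℂ (semidirectPos M.act M.act.dual (TensorAlgebra.ι ℂ f))) ∘ₗ
        (semidirectNeg M.act M.act.dual).toLinearMap ∘ₗ TensorAlgebra.ι ℂ)
      (ψ := (semidirectLift M Rm Rp).toLinearMap ∘ₗ
        (TensorSemidirect.ofGroupAlgebra (M.act.prod M.act.dual)).toLinearMap ∘ₗ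
        M.heisenbergForm f) ?_
    · exact LinearMap.congr_fun this v
    · intro g w hw
      simp only [LinearMap.comp_apply, AlgHom.toLinearMap_apply, LinearMap.sub_apply,
        LinearMap.mulLeft_apply, LinearMap.mulRight_apply, map_sub, map_mul, semidirectLift_pos,
        semidirectLift_neg, tensorCoaction_ι, M.rTensor_coaction_of_mem _ hw,
        Algebra.TensorProduct.map_tmul, AlgHom.id_apply, Algebra.TensorProduct.tmul_mul_tmul,
        one_mul, mul_one, M.heisenbergForm_of_mem f hw, map_smul, semidirectLift_of]
      rw [← TensorProduct.sub_tmul, comm, M.heisenbergForm_of_mem f hw, map_smul,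
        groupLift_apply]
      rfl

/-- The coaction on the double, for relations `R⁻` that are spanned by homogeneous elements. -/
def coaction (hRm : Rm ≤ ⨆ g, Rm ⊓ tensorDegree M g) :
    Heis M Rm Rp →ₐ[ℂ] Heis M Rm Rp ⊗[ℂ] MonoidAlgebra ℂ G :=
  RingQuot.liftAlgHom ℂ ⟨semidirectLift M Rm Rp, fun _ _ h => semidirectLift_rel M Rp hRm h⟩

/-! ### The resulting grading of a double -/

variable (hRm : Rm ≤ ⨆ g, Rm ⊓ tensorDegree M g)

/-- The component of degree `g` of a double. -/
abbrev degree (g : G) : Submodule ℂ (Heis M Rm Rp) := degreePart (coaction M Rp hRm).toLinearMap g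

theorem hneg_mem {g : G} {x : TensorAlgebra ℂ Y} (hx : x ∈ tensorDegree M g) :
    hneg M Rm Rp x ∈ degree M Rp hRm g := by
  have e : tensorCoaction M x = x ⊗ₜ MonoidAlgebra.of ℂ G g := hx
  rw [mem_degreePart, AlgHom.toLinearMap_apply]
  simp only [hneg, neg, AlgHom.comp_apply, coaction, RingQuot.liftAlgHom_mkAlgHom_apply]
  rw [semidirectLift_neg, e, Algebra.TensorProduct.map_tmul]
  rfl

theorem hpos_mem (x : TensorAlgebra ℂ (Module.Dual ℂ Y)) :
    hpos M Rm Rp x ∈ degree M Rp hRm 1 := by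
  rw [mem_degreePart, AlgHom.toLinearMap_apply]
  simp only [hpos, pos, AlgHom.comp_apply, coaction, RingQuot.liftAlgHom_mkAlgHom_apply]
  rw [semidirectLift_pos, map_one]
  rfl

theorem hgrp_mem (g : G) : hgrp M Rm Rp (MonoidAlgebra.of ℂ G g) ∈ degree M Rp hRm g := by
  rw [mem_degreePart, AlgHom.toLinearMap_apply]
  simp only [hgrp, grp, AlgHom.comp_apply, coaction, RingQuot.liftAlgHom_mkAlgHom_apply]
  rw [semidirectLift_of]
  rfl

theorem iSup_degree : ⨆ g, degree M Rp hRm g = ⊤ := by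
  refine iSup_degreePart_eq_top _ (adjoin_generators _ _ _ _ _) ?_
  rintro _ ((⟨v, rfl⟩ | ⟨f, rfl⟩) | ⟨g, rfl⟩)
  · have h0 : (⨆ g, tensorDegree M g) ≤ (⨆ g, degree M Rp hRm g).comap
        (hneg M Rm Rp).toLinearMap :=
      iSup_le fun g w hw => Submodule.mem_iSup_of_mem g (hneg_mem M Rp hRm hw)
    rw [iSup_tensorDegree] at h0
    exact h0 Submodule.mem_top
  · exact Submodule.mem_iSup_of_mem 1 (hpos_mem M Rp hRm _)
  · exact Submodule.mem_iSup_of_mem g (hgrp_mem M Rp hRm g)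

end Double

end DoubleCoaction
end

noncomputable section

/-! ### The maximal ideal `I_β⁻` is spanned by homogeneous elements -/

section Homogeneous

variable {G : Type*} [Group G] {Y : Type*} [AddCommGroup Y] [Module ℂ Y] (M : YDModule G Y)

theorem tensorMap_mem_tensorDegree (k : G) {g : G} {x : TensorAlgebra ℂ Y}
    (hx : x ∈ tensorDegree M g) : tensorMap (M.act k) x ∈ tensorDegree M (k * g * k⁻¹) := by
  -- The coaction intertwines the action of `k` with the action on the first factor and conjugation
  -- on the second; this is checked on $Y$.
  have key : (tensorCoaction M).comp (tensorMap (M.act k)) =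
      (Algebra.TensorProduct.map (tensorMap (M.act k))
        (MonoidAlgebra.mapDomainAlgHom ℂ ℂ (MulAut.conj k).toMonoidHom)).comp
          (tensorCoaction M) := by
    refine TensorAlgebra.hom_ext ?_
    refine M.ext_of_gr (W := TensorAlgebra ℂ Y ⊗[ℂ] MonoidAlgebra ℂ G) fun h v hv => ?_
    simp only [LinearMap.comp_apply, AlgHom.toLinearMap_apply, AlgHom.comp_apply, tensorMap,
      TensorAlgebra.lift_ι_apply, tensorCoaction_ι, M.rTensor_coaction_of_mem _ hv,
      M.rTensor_coaction_of_mem _ (M.act_mem k hv), Algebra.TensorProduct.map_tmul]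
    simp
  have e : tensorCoaction M x = x ⊗ₜ MonoidAlgebra.of ℂ G g := hx
  have := DFunLike.congr_fun key x
  rw [AlgHom.comp_apply, AlgHom.comp_apply, e, Algebra.TensorProduct.map_tmul] at this
  rw [mem_degreePart, AlgHom.toLinearMap_apply, this]
  simp

theorem tensorMap_tensorProj (k g : G) (x : TensorAlgebra ℂ Y) :
    tensorMap (M.act k) (tensorProj M g x) =
      tensorProj M (k * g * k⁻¹) (tensorMap (M.act k) x) :=
  map_degreeProj (iSup_tensorDegree M) (tensorMap (M.act k)).toLinearMap
    (MulAut.conj k).injective (fun _ _ hx => tensorMap_mem_tensorDegree M k hx) g x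

/-- The augmentation $\varepsilon$ kills $Y$, hence
$(\varepsilon\otimes\mathrm{id})\Delta(x)=\varepsilon(x)\otimes1$. If $\varepsilon(x)=0$, every
coefficient vanishes. -/
theorem algebraMapInv_tensorProj (g : G) {x : TensorAlgebra ℂ Y}
    (hx : TensorAlgebra.algebraMapInv x = 0) :
    TensorAlgebra.algebraMapInv (tensorProj M g x) = 0 := by
  let ε : TensorAlgebra ℂ Y →ₐ[ℂ] ℂ := TensorAlgebra.algebraMapInv
  have key : (Algebra.TensorProduct.map ε (AlgHom.id ℂ (MonoidAlgebra ℂ G))).comp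
      (tensorCoaction M) = Algebra.TensorProduct.includeLeft.comp ε := by
    refine TensorAlgebra.hom_ext ?_
    refine M.ext_of_gr (W := ℂ ⊗[ℂ] MonoidAlgebra ℂ G) fun h v hv => ?_
    simp only [LinearMap.comp_apply, AlgHom.toLinearMap_apply, AlgHom.comp_apply,
      tensorCoaction_ι, M.rTensor_coaction_of_mem _ hv, Algebra.TensorProduct.map_tmul]
    simp [ε, TensorAlgebra.algebraMapInv]
  have h1 : LinearMap.rTensor (MonoidAlgebra ℂ G) ε.toLinearMap (tensorCoaction M x) = 0 := by
    have := DFunLike.congr_fun key x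
    rw [AlgHom.comp_apply, AlgHom.comp_apply, show ε x = 0 from hx, map_zero] at this
    exact this
  have h2 := map_tensorCoeff ε.toLinearMap g (tensorCoaction M x)
  rw [h1, map_zero] at h2
  exact h2

theorem tensorProj_mem_range_pow (n : ℕ) (g : G) {x : TensorAlgebra ℂ Y}
    (hx : x ∈ LinearMap.range (TensorAlgebra.ι ℂ : Y →ₗ[ℂ] TensorAlgebra ℂ Y) ^ n) :
    tensorProj M g x ∈ LinearMap.range (TensorAlgebra.ι ℂ : Y →ₗ[ℂ] TensorAlgebra ℂ Y) ^ n := by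
  induction n generalizing g x with
  | zero =>
    rw [pow_zero, Submodule.mem_one] at hx
    obtain ⟨c, rfl⟩ := hx
    by_cases hg : 1 = g
    · subst hg
      rw [tensorProj, degreeProj_of_mem _ (algebraMap_mem_degreePart (tensorCoaction M) c),
        pow_zero]
      exact Submodule.algebraMap_mem c
    · rw [tensorProj,
        degreeProj_of_mem_of_ne _ (algebraMap_mem_degreePart (tensorCoaction M) c) hg]
      exact zero_mem _
  | succ n ih =>
    rw [pow_succ'] at hx ⊢
    induction hx using Submodule.mul_induction_on' with
    | add x _ y _ hx hy => rw [map_add]; exact add_mem hx hy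
    | mem_mul_mem a ha b hb =>
      obtain ⟨v, rfl⟩ := ha
      set L := LinearMap.range (TensorAlgebra.ι ℂ : Y →ₗ[ℂ] TensorAlgebra ℂ Y) with hL
      -- Peel off a first letter $w\in Y_h$: the degree $g$ part of $wb$ is $w$ times the degree
      -- $h^{-1}g$ part of $b$.
      have h0 : (⨆ h, M.gr h) ≤ (L * L ^ n).comap
          (tensorProj M g ∘ₗ LinearMap.mulRight ℂ b ∘ₗ TensorAlgebra.ι ℂ) := by
        refine iSup_le fun h w hw => ?_
        have := mul_degreeProj (iSup_tensorDegree M) (ι_mem_tensorDegree M hw) (h⁻¹ * g) b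
        rw [mul_inv_cancel_left] at this
        rw [Submodule.mem_comap, LinearMap.comp_apply, LinearMap.comp_apply,
          LinearMap.mulRight_apply, tensorProj, ← this]
        exact Submodule.mul_mem_mul ⟨w, rfl⟩ (ih _ hb)
      rw [M.iSup_eq_top] at h0
      exact h0 (Submodule.mem_top (x := v))

theorem decompose_tensorProj (g : G) (x : TensorAlgebra ℂ Y) (n : ℕ) :
    (DirectSum.decompose
      (fun n : ℕ => LinearMap.range (TensorAlgebra.ι ℂ : Y →ₗ[ℂ] TensorAlgebra ℂ Y) ^ n)
        (tensorProj M g x) n : TensorAlgebra ℂ Y) =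
      tensorProj M g (DirectSum.decompose
        (fun n : ℕ => LinearMap.range (TensorAlgebra.ι ℂ : Y →ₗ[ℂ] TensorAlgebra ℂ Y) ^ n) x n :
          TensorAlgebra ℂ Y) := by
  induction x using DirectSum.Decomposition.inductionOn
    (fun n : ℕ => LinearMap.range (TensorAlgebra.ι ℂ : Y →ₗ[ℂ] TensorAlgebra ℂ Y) ^ n) with
  | zero => simp
  | @homogeneous i y =>
    have hp := tensorProj_mem_range_pow M i g y.2
    by_cases hi : i = n
    · subst hi
      rw [DirectSum.decompose_of_mem_same _ hp, DirectSum.decompose_of_mem_same _ y.2]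
    · rw [DirectSum.decompose_of_mem_ne _ hp hi, DirectSum.decompose_of_mem_ne _ y.2 hi, map_zero]
  | add y z hy hz =>
    rw [map_add, DirectSum.decompose_add, DirectSum.decompose_add, DirectSum.add_apply,
      DirectSum.add_apply, Submodule.coe_add, Submodule.coe_add, hy, hz, map_add]

/-- The span of the homogeneous components of the elements of `I`. -/
def homogeneousSpan (I : Submodule ℂ (TensorAlgebra ℂ Y)) : Submodule ℂ (TensorAlgebra ℂ Y) :=
  ⨆ g, I.map (tensorProj M g)

theorem tensorProj_mem_homogeneousSpan {I : Submodule ℂ (TensorAlgebra ℂ Y)} (g : G)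
    {x : TensorAlgebra ℂ Y} (hx : x ∈ I) : tensorProj M g x ∈ homogeneousSpan M I :=
  Submodule.mem_iSup_of_mem g (Submodule.mem_map_of_mem hx)

theorem homogeneousSpan_le {I J : Submodule ℂ (TensorAlgebra ℂ Y)}
    (h : ∀ g, ∀ x ∈ I, tensorProj M g x ∈ J) : homogeneousSpan M I ≤ J := by
  refine iSup_le fun g => ?_
  rintro _ ⟨x, hx, rfl⟩
  exact h g x hx

/-- Multiplication by homogeneous elements, the action of $G$, the $\mathbb N$-projections and the
augmentation all carry $G$-components to $G$-components, up to a shift or conjugation of the degree.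
-/
theorem IsGradedInvariantIdeal.homogeneousSpan {I : Submodule ℂ (TensorAlgebra ℂ Y)}
    (hI : IsGradedInvariantIdeal M.act I) :
    IsGradedInvariantIdeal M.act (homogeneousSpan M I) where
  mul_mem_left a x hx := by
    have h0 : (⨆ h, tensorDegree M h) ≤
        (_root_.homogeneousSpan M I).comap (LinearMap.mulRight ℂ x) := by
      refine iSup_le fun h b hb => ?_
      refine homogeneousSpan_le M
        (J := (_root_.homogeneousSpan M I).comap (LinearMap.mulLeft ℂ b)) (fun g y hy => ?_) hx
      rw [Submodule.mem_comap, LinearMap.mulLeft_apply,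
        mul_degreeProj (iSup_tensorDegree M) hb]
      exact tensorProj_mem_homogeneousSpan M _ (hI.mul_mem_left b y hy)
    rw [iSup_tensorDegree] at h0
    exact h0 (Submodule.mem_top (x := a))
  mul_mem_right a x hx := by
    have h0 : (⨆ h, tensorDegree M h) ≤
        (_root_.homogeneousSpan M I).comap (LinearMap.mulLeft ℂ x) := by
      refine iSup_le fun h b hb => ?_
      refine homogeneousSpan_le M
        (J := (_root_.homogeneousSpan M I).comap (LinearMap.mulRight ℂ b)) (fun g y hy => ?_) hx
      rw [Submodule.mem_comap, LinearMap.mulRight_apply,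
        degreeProj_mul (iSup_tensorDegree M) hb]
      exact tensorProj_mem_homogeneousSpan M _ (hI.mul_mem_right b y hy)
    rw [iSup_tensorDegree] at h0
    exact h0 (Submodule.mem_top (x := a))
  graded x hx n := by
    refine homogeneousSpan_le M (J := (_root_.homogeneousSpan M I).comap
      (GradedAlgebra.proj (fun n : ℕ =>
        LinearMap.range (TensorAlgebra.ι ℂ : Y →ₗ[ℂ] TensorAlgebra ℂ Y) ^ n) n))
      (fun g y hy => ?_) hx
    rw [Submodule.mem_comap, GradedAlgebra.proj_apply, decompose_tensorProj]
    exact tensorProj_mem_homogeneousSpan M g (hI.graded y hy n)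
  le_augmentation x hx :=
    homogeneousSpan_le M
      (J := LinearMap.ker (TensorAlgebra.algebraMapInv (R := ℂ) (M := Y)).toLinearMap)
      (fun g y hy => algebraMapInv_tensorProj M g (hI.le_augmentation y hy)) hx
  invariant k x hx := by
    refine homogeneousSpan_le M
      (J := (_root_.homogeneousSpan M I).comap (tensorMap (M.act k)).toLinearMap)
      (fun g y hy => ?_) hx
    rw [Submodule.mem_comap, AlgHom.toLinearMap_apply, tensorMap_tensorProj]
    exact tensorProj_mem_homogeneousSpan M _ (hI.invariant k y hy)

/-- Provides the grading of the free double, with no circular appeal to $I_\beta^-$. -/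
theorem bot_le_iSup_inf_tensorDegree :
    (⊥ : Submodule ℂ (TensorAlgebra ℂ Y)) ≤ ⨆ g, ⊥ ⊓ tensorDegree M g :=
  bot_le

-- Let $P_g$ be the projections of the free double. Since $f$ has degree $1$, $[f,P_g y]=P_g[f,y]$,
-- and $P_g(ak)=P_{gk^{-1}}(a)\,k$ for $k\in G$. Thus projecting $I\cdot\mathbb CG$ only replaces
-- elements of $I$ by their components.
open Double in
theorem CommutesIntoNeg.homogeneousSpan {I : Submodule ℂ (TensorAlgebra ℂ Y)}
    (hI : CommutesIntoNeg M.act M.act.dual M.heisenbergForm I) :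
    CommutesIntoNeg M.act M.act.dual M.heisenbergForm (homogeneousSpan M I) := by
  intro f x hx
  set P : G → Heis M ⊥ ⊥ →ₗ[ℂ] Heis M ⊥ ⊥ :=
    degreeProj (Double.coaction M ⊥ (bot_le_iSup_inf_tensorDegree M)).toLinearMap
  have htop := iSup_degree M ⊥ (bot_le_iSup_inf_tensorDegree M)
  have hproj : ∀ g y, hneg M ⊥ ⊥ (tensorProj M g y) = P g (hneg M ⊥ ⊥ y) := fun g y =>
    map_degreeProj (iSup_tensorDegree M) (hneg M ⊥ ⊥).toLinearMap Function.injective_id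
      (fun _ _ hx => hneg_mem M ⊥ (bot_le_iSup_inf_tensorDegree M) hx) g y
  have hf := hpos_mem M (Rm := ⊥) ⊥ (bot_le_iSup_inf_tensorDegree M) (TensorAlgebra.ι ℂ f)
  set S := Submodule.span ℂ {z : Heis M ⊥ ⊥ | ∃ a ∈ _root_.homogeneousSpan M I, ∃ g : G,
      z = hneg M ⊥ ⊥ a * hgrp M ⊥ ⊥ (MonoidAlgebra.of ℂ G g)} with hS
  refine homogeneousSpan_le M (J := S.comap
    ((LinearMap.mulLeft ℂ (hpos M ⊥ ⊥ (TensorAlgebra.ι ℂ f)) -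
      LinearMap.mulRight ℂ (hpos M ⊥ ⊥ (TensorAlgebra.ι ℂ f))) ∘ₗ (hneg M ⊥ ⊥).toLinearMap))
    (fun g y hy => ?_) hx
  rw [Submodule.mem_comap, LinearMap.comp_apply, LinearMap.sub_apply, LinearMap.mulLeft_apply,
    LinearMap.mulRight_apply, AlgHom.toLinearMap_apply, hproj,
    mul_degreeProj htop hf, degreeProj_mul htop hf, one_mul, mul_one, ← map_sub]
  have h1 : Submodule.span ℂ {z : Heis M ⊥ ⊥ | ∃ a ∈ I, ∃ g : G,
      z = hneg M ⊥ ⊥ a * hgrp M ⊥ ⊥ (MonoidAlgebra.of ℂ G g)} ≤ S.comap (P g) := by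
    refine Submodule.span_le.2 ?_
    rintro _ ⟨a, ha, k, rfl⟩
    have := degreeProj_mul htop (hgrp_mem M ⊥ (bot_le_iSup_inf_tensorDegree M) k) (g * k⁻¹)
      (hneg M ⊥ ⊥ a)
    rw [inv_mul_cancel_right] at this
    rw [SetLike.mem_coe, Submodule.mem_comap, ← this]
    exact Submodule.subset_span
      ⟨tensorProj M (g * k⁻¹) a, tensorProj_mem_homogeneousSpan M _ ha, k, by rw [hproj]⟩
  exact h1 (hI f y hy)

/-- The homogeneous span of each admissible `I` is again admissible, so it is one of the ideals
summed in $I_\beta^-$; it also contains `I`. -/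
theorem maxNegIdeal_le_iSup_inf_tensorDegree :
    maxNegIdeal M.act M.act.dual M.heisenbergForm ≤
      ⨆ g, maxNegIdeal M.act M.act.dual M.heisenbergForm ⊓ tensorDegree M g := by
  refine sSup_le fun I hI => ?_
  have hle : homogeneousSpan M I ≤ maxNegIdeal M.act M.act.dual M.heisenbergForm :=
    le_sSup ⟨hI.1.homogeneousSpan M, hI.2.homogeneousSpan M⟩
  intro x hx
  refine (iSup_mono fun g => ?_ : (⨆ g, I.map (tensorProj M g)) ≤ _)
    (mem_iSup_map_degreeProj (iSup_tensorDegree M) I hx)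
  rintro _ ⟨y, hy, rfl⟩
  exact ⟨hle (tensorProj_mem_homogeneousSpan M g hy), degreeProj_mem (iSup_tensorDegree M) g y⟩

end Homogeneous

/-! ### The Yetter-Drinfeld structure of the Heisenberg double -/

namespace HeisenbergDouble

variable {G : Type*} [Group G] {Y : Type*} [AddCommGroup Y] [Module ℂ Y] (M : YDModule G Y)

theorem conj_apply (g : G) (x : HeisenbergDouble M) : conj M g x = ofG M g * x * ofG M g⁻¹ :=
  (mul_assoc _ _ _).symm

theorem conj_one (g : G) : conj M g 1 = 1 := by
  rw [conj_apply, mul_one, ← map_mul, mul_inv_cancel, map_one]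

theorem conj_mul (g : G) (x y : HeisenbergDouble M) :
    conj M g (x * y) = conj M g x * conj M g y := by
  have h : ofG M g⁻¹ * ofG M g = 1 := by rw [← map_mul, inv_mul_cancel, map_one]
  simp only [conj_apply]
  calc ofG M g * (x * y) * ofG M g⁻¹ = ofG M g * x * 1 * y * ofG M g⁻¹ := by
        simp only [mul_assoc, one_mul]
    _ = _ := by rw [← h]; simp only [mul_assoc]

/-- The component of degree `g` of the Heisenberg double. -/
abbrev gr (g : G) : Submodule ℂ (HeisenbergDouble M) :=
  Double.degree M _ (maxNegIdeal_le_iSup_inf_tensorDegree M) g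

theorem ofG_mem_gr (g : G) : ofG M g ∈ gr M g := Double.hgrp_mem M _ _ g

theorem mul_mem_gr {g h : G} {x y : HeisenbergDouble M} (hx : x ∈ gr M g) (hy : y ∈ gr M h) :
    x * y ∈ gr M (g * h) :=
  mul_mem_degreePart _ hx hy

theorem conj_mem_gr (g : G) {h : G} {x : HeisenbergDouble M} (hx : x ∈ gr M h) :
    conj M g x ∈ gr M (g * h * g⁻¹) := by
  rw [conj_apply]
  exact mul_mem_gr M (mul_mem_gr M (ofG_mem_gr M g) hx) (ofG_mem_gr M g⁻¹)

/-- The Heisenberg double as a Yetter-Drinfeld module, with the conjugation action. -/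
def ydModule : YDModule G (HeisenbergDouble M) where
  act := conj M
  gr := gr M
  indep := iSupIndep_degreePart _
  iSup_eq_top := Double.iSup_degree M _ _
  compat g h := by
    -- Conjugation by $g$ gives one inclusion; conjugation by $g^{-1}$ supplies preimages for the
    -- other.
    refine le_antisymm (Submodule.map_le_iff_le_comap.2 fun x hx => conj_mem_gr M g hx)
      fun x hx => ⟨conj M g⁻¹ x, ?_, Representation.self_inv_apply (conj M) g x⟩
    have := conj_mem_gr M g⁻¹ hx
    rwa [show g⁻¹ * (g * h * g⁻¹) * g⁻¹⁻¹ = h by group] at this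

theorem isAlgebra_ydModule : (ydModule M).IsAlgebra where
  mul :=
    { map_act := fun g t => by
        induction t with
        | zero => simp only [map_zero]
        | add a b ha hb => simp only [map_add, ha, hb]
        | tmul a b => exact (conj_mul M g a b).symm
      map_gr := fun g t ht => by
        -- The degree $g$ part of the tensor square is the sum over $h$ of the parts of degrees $h$
        -- and $h^{-1}g$, so pure tensors suffice.
        refine (iSup_le fun h => Submodule.map₂_le.2 fun a ha b hb => ?_ :
          ((ydModule M).tensor (ydModule M)).gr g ≤
            ((ydModule M).gr g).comap (LinearMap.mul' ℂ (HeisenbergDouble M))) ht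
        have := mul_mem_gr M ha hb
        rwa [mul_inv_cancel_left] at this }
  unit :=
    { map_act := fun g c => by
        change algebraMap ℂ (HeisenbergDouble M) c = conj M g (algebraMap ℂ _ c)
        rw [Algebra.algebraMap_eq_smul_one, map_smul, conj_one]
      map_gr := fun g c hc => by
        by_cases hg : g = 1
        · subst hg
          exact algebraMap_mem_degreePart _ c
        · have : c ∈ ⨆ (_ : g = 1), (⊤ : Submodule ℂ ℂ) := hc
          simp only [hg, iSup_false, Submodule.mem_bot] at this
          rw [this, map_zero]
          exact zero_mem _ }

end HeisenbergDouble

end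

theorem mainTheorem5 {G : Type*} [Group G] {Y : Type*} [AddCommGroup Y] [Module ℂ Y]
    [FiniteDimensional ℂ Y] (M : YDModule G Y) :
    -- the action of `G` on `H_Y` by conjugation is an action by algebra automorphisms
    ((∀ (g : G) (x : HeisenbergDouble M),
        HeisenbergDouble.conj M g x = HeisenbergDouble.ofG M g * x * HeisenbergDouble.ofG M g⁻¹) ∧
      (∀ g : G, HeisenbergDouble.conj M g 1 = 1) ∧
      (∀ (g : G) (x y : HeisenbergDouble M), HeisenbergDouble.conj M g (x * y) =
        HeisenbergDouble.conj M g x * HeisenbergDouble.conj M g y)) ∧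
    ∃ H : YDModule G (HeisenbergDouble M),
      -- the grading of `H` is an algebra grading, in which `g`, `Y_g` and `Y*` have degree
      -- `g`, `g` and `1`
      (1 : HeisenbergDouble M) ∈ H.gr 1 ∧
      (∀ g h : G, ∀ x ∈ H.gr g, ∀ y ∈ H.gr h, x * y ∈ H.gr (g * h)) ∧
      (∀ g : G, HeisenbergDouble.ofG M g ∈ H.gr g) ∧
      (∀ (g : G), ∀ v ∈ M.gr g, HeisenbergDouble.ofY M v ∈ H.gr g) ∧
      (∀ f : Module.Dual ℂ Y, HeisenbergDouble.ofDual M f ∈ H.gr 1) ∧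
      -- together with the conjugation action, it makes `H_Y` an algebra in the category of
      -- Yetter-Drinfeld modules
      H.act = HeisenbergDouble.conj M ∧
      H.IsAlgebra := by
  exact ⟨⟨HeisenbergDouble.conj_apply M, HeisenbergDouble.conj_one M,
      HeisenbergDouble.conj_mul M⟩,
    HeisenbergDouble.ydModule M, one_mem_degreePart _,
    fun _ _ _ hx _ hy => HeisenbergDouble.mul_mem_gr M hx hy, HeisenbergDouble.ofG_mem_gr M,
    fun _ _ hv => Double.hneg_mem M _ _ (ι_mem_tensorDegree M hv),
    fun _ => Double.hpos_mem M _ _ _, rfl, HeisenbergDouble.isAlgebra_ydModule M⟩
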